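/- Let $\mathfrak g$ be a finite-dimensional real semisimple Lie algebra with Killing form $\kappa$, and let $\mathfrak g=\mathfrak g_0\oplus\mathfrak m$ be a Cartan decomposition: $[\mathfrak g_0,\mathfrak g_0]\subset\mathfrak g_0$, $[\mathfrak g_0,\mathfrak m]\subset\mathfrak m$, $[\mathfrak m,\mathfrak m]\subset\mathfrak g_0$, $\kappa(\mathfrak g_0,\mathfrak m)=0$, and $\kappa$ is negative definite on $\mathfrak g_0$ and positive definite on $\mathfrak m$. Let $\mathfrak a\subset\mathfrak m$ be a maximal abelian subspace and $n=\dim\mathfrak a$. Let $\mathfrak b=\mathfrak a^\perp$ be the $\kappa$-orthogonal complement of $\mathfrak a$ in $\mathfrak m$, let $\mathfrak g_{\mathfrak a}=\{X\in\mathfrak g_0: [X,\mathfrak a]=0\}$, and let $\mathfrak p$ be the $\kappa$-orthogonal complement of $\mathfrak g_{\mathfrak a}$ in $\mathfrak g_0$. The map $B\mapsto \mathrm{ad}_B|_{\mathfrak a}$ is an injection $\mathfrak b\to\mathrm{Hom}(\mathfrak a,\mathfrak p)$; let $\mathbf A\subset \mathrm{Hom}(\mathfrak a,\mathfrak p)$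 be its image, which is thereby identified with $\mathfrak b$. For $B\in\mathfrak b$ let $\Phi|_B\in\mathfrak p\otimes\Lambda^2\mathfrak a^*$ be given by $\Phi|_B(A_1,A_2)=[[A_1,B],[A_2,B]]$, and regard $\Phi$ as a map on $M=\mathfrak a\oplus\mathbf A$ that does not depend on the component in $\mathfrak a$. We use the following notions. For a subspace $\mathfrak c\subset\mathfrak a$ put $\mathrm{Ker}(\mathbf A,\mathfrak c)=\{Q\in\mathbf A: Q|_{\mathfrak c}=0\}$. A flag $0\subset\mathfrak a_1\subset\dots\subset\mathfrak a_n=\mathfrak a$ with $\dim\mathfrak a_h=h$ is generic if each $\dim\mathrm{Ker}(\mathbf A,\mathfrak a_h)$ is minimal among all $h$-dimensional subspaces of $\mathfrak a$. The characters $s_1,\dots,s_n$ of $\mathbf A$ are defined by $s_1+\dots+s_j=\dim\mathbf A-\dim\mathrm{Ker}(\mathbf A,\mathfrak a_j)$ for a generic flag. The first prolongation $\mathbf A^{(1)}$ is the space of linear maps $Q:\mathfrak a\to\mathbf A$ with $Q(X)(Y)=Q(Y)(X)$ for all $X,Y\in\mathfrak a$. The tableau $\mathbf A$ is involutive if $\dim\mathbf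 A^{(1)}=s_1+2s_2+\dots+ns_n$. The space $B^{0,2}(\mathbf A)\subset\mathfrak p\otimes\Lambda^2\mathfrak a^*$ is the image of $\delta:\mathrm{Hom}(\mathfrak a,\mathbf A)\to\mathfrak p\otimes\Lambda^2\mathfrak a^*$, $(\delta\phi)(X_1,X_2)=\phi(X_2)(X_1)-\phi(X_1)(X_2)$. Then: 1. $\mathbf A$ is involutive. 2. The characters of $\mathbf A$ are $s_1=\dim\mathfrak b$ and $s_j=0$ for $2\le j\le n$. 3. The map $\mathfrak p\to\mathbf A^{(1)}$ that sends $X$ to $A_1\mapsto \mathrm{ad}_{[X,A_1]}|_{\mathfrak a}$ is a linear isomorphism. 4. $\Phi|_B\in B^{0,2}(\mathbf A)$ for every $B\in\mathfrak b$. 5. $\Phi$ satisfies the torsion condition: $\Phi$ is differentiable, and for all $m\in M$, $Q\in\mathbf A^{(1)}$ and $A_1,A_2,A_3\in\mathfrak a$, the sum over the cyclic permutations of $(1,2,3)$ $$\sum_{(1,2,3)}\Phi_*|_m\bigl(A_1+Q(A_1)\bigr)(A_2,A_3)=0,$$ where $\Phi_*|_m$ is the differential of $\Phi$ at $m$. 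-/

import Mathlib

/-! ### Tableaux -/

namespace Tableau

section Algebra

variable {K V W : Type*} [Field K] [AddCommGroup V] [Module K V] [AddCommGroup W] [Module K W]

/-- `Ker(A, U)`: the elements of the tableau `A ⊆ Hom(V, W)` that vanish on the subspace `U`. -/
def kerOn (A : Submodule K (V →ₗ[K] W)) (U : Submodule K V) : Submodule K (V →ₗ[K] W) where
  carrier := {Q | Q ∈ A ∧ ∀ x ∈ U, Q x = 0}
  zero_mem' := ⟨A.zero_mem, fun _ _ => rfl⟩
  add_mem' := fun {P Q} hP hQ => ⟨A.add_mem hP.1 hQ.1, fun x hx => by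
    rw [LinearMap.add_apply, hP.2 x hx, hQ.2 x hx, add_zero]⟩
  smul_mem' := fun c Q hQ => ⟨A.smul_mem c hQ.1, fun x hx => by
    rw [LinearMap.smul_apply, hQ.2 x hx, smul_zero]⟩

/-- A subspace `U` is generic for `A` if `dim Ker(A, U)` is minimal among all subspaces of the
same dimension. -/
def IsGeneric (A : Submodule K (V →ₗ[K] W)) (U : Submodule K V) : Prop :=
  ∀ U' : Submodule K V, Module.finrank K U' = Module.finrank K U →
    Module.finrank K (kerOn A U) ≤ Module.finrank K (kerOn A U')

/-- A generic flag `0 = F 0 ⊂ F 1 ⊂ ⋯ ⊂ F n = V`, where `n = dim V`. The flag is indexed by `ℕ`;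
monotonicity forces `F h = V` for `h ≥ n`. -/
structure IsGenericFlag (A : Submodule K (V →ₗ[K] W)) (F : ℕ → Submodule K V) : Prop where
  mono : Monotone F
  finrank_eq : ∀ h ≤ Module.finrank K V, Module.finrank K (F h) = h
  generic : ∀ h, 1 ≤ h → h ≤ Module.finrank K V → IsGeneric A (F h)

/-- `s 1, …, s n` are the characters of the tableau `A`: there is a generic flag, and for every
generic flag `F` and `1 ≤ j ≤ n`, `s 1 + ⋯ + s j` is the codimension of `Ker(A, F j)` in `A`
(written additively). -/
def HasCharacters (A : Submodule K (V →ₗ[K] W)) (s : ℕ → ℕ) : Prop :=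
  (∃ F, IsGenericFlag A F) ∧
    ∀ F, IsGenericFlag A F → ∀ j, 1 ≤ j → j ≤ Module.finrank K V →
      (∑ i ∈ Finset.Icc 1 j, s i) + Module.finrank K (kerOn A (F j)) = Module.finrank K A

/-- The first prolongation `A⁽¹⁾ ⊆ Hom(V, A)`. -/
def prolongation (A : Submodule K (V →ₗ[K] W)) : Submodule K (V →ₗ[K] A) where
  carrier := {Q | ∀ X Y : V, (Q X : V →ₗ[K] W) Y = (Q Y : V →ₗ[K] W) X}
  zero_mem' := fun _ _ => rfl
  add_mem' := fun {P Q} hP hQ X Y => by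
    simp only [LinearMap.add_apply, Submodule.coe_add, hP X Y, hQ X Y]
  smul_mem' := fun c Q hQ X Y => by
    simp only [LinearMap.smul_apply, Submodule.coe_smul, hQ X Y]

/-- `A` is involutive: `dim A⁽¹⁾ = s₁ + 2 s₂ + ⋯ + n sₙ`, where `s₁, …, sₙ` are the characters. -/
def IsInvolutive (A : Submodule K (V →ₗ[K] W)) : Prop :=
  ∃ s : ℕ → ℕ, HasCharacters A s ∧
    Module.finrank K (prolongation A) = ∑ j ∈ Finset.Icc 1 (Module.finrank K V), j * s j

/-- The `W`-valued `2`-form on `V` given by an alternating bilinear map. -/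
def twoForm (β : V →ₗ[K] V →ₗ[K] W) (h : ∀ x, β x x = 0) : V [⋀^Fin 2]→ₗ[K] W where
  toFun v := β (v 0) (v 1)
  map_update_add' := by
    intro inst v i x y
    rw [Subsingleton.elim inst (instDecidableEqFin 2)]
    fin_cases i <;> simp
  map_update_smul' := by
    intro inst v i c x
    rw [Subsingleton.elim inst (instDecidableEqFin 2)]
    fin_cases i <;> simp
  map_eq_zero_of_eq' := by
    intro v i j hv hij
    have h01 : v 0 = v 1 := by
      fin_cases i <;> fin_cases j <;> simp_all
    rw [h01]
    exact h _

/-- The Spencer differential `δ^{1,1} : C^{1,1}(A) = Hom(V, A) → C^{0,2}(A) = W ⊗ Λ²V*`,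
`(δφ)(X₁, X₂) = φ(X₂)(X₁) - φ(X₁)(X₂)`. -/
def spencerDelta (A : Submodule K (V →ₗ[K] W)) : (V →ₗ[K] A) →ₗ[K] V [⋀^Fin 2]→ₗ[K] W where
  toFun φ := twoForm ((A.subtype ∘ₗ φ).flip - A.subtype ∘ₗ φ) (fun x => by simp)
  map_add' := fun φ ψ => by
    ext v
    simp [twoForm]
    abel
  map_smul' := fun c φ => by
    ext v
    simp [twoForm, smul_sub]

/-- `B^{0,2}(A)`, the space of Spencer coboundaries in `C^{0,2}(A) = W ⊗ Λ²V*`. -/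
def B02 (A : Submodule K (V →ₗ[K] W)) : Submodule K (V [⋀^Fin 2]→ₗ[K] W) :=
  LinearMap.range (spencerDelta A)

end Algebra

section Torsion

instance finiteDimensional_twoForms {V W : Type*} [AddCommGroup V] [Module ℝ V]
    [FiniteDimensional ℝ V] [AddCommGroup W] [Module ℝ W] [FiniteDimensional ℝ W] :
    FiniteDimensional ℝ (V [⋀^Fin 2]→ₗ[ℝ] W) :=
  Module.Finite.of_injective
    (AlternatingMap.toMultilinearMapLM : (V [⋀^Fin 2]→ₗ[ℝ] W) →ₗ[ℝ] _)
    AlternatingMap.coe_multilinearMap_injective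

/-- `L` is the (Fréchet) differential at `m` of the map `f` between finite-dimensional real vector
spaces: it is so in linear coordinates. (The choice of the bases is immaterial.) -/
def HasDifferentialAt {E F : Type*} [AddCommGroup E] [Module ℝ E] [FiniteDimensional ℝ E]
    [AddCommGroup F] [Module ℝ F] [FiniteDimensional ℝ F]
    (f : E → F) (L : E →ₗ[ℝ] F) (m : E) : Prop :=
  HasFDerivAt
    (fun x => (Module.finBasis ℝ F).equivFun (f ((Module.finBasis ℝ E).equivFun.symm x)))
    (LinearMap.toContinuousLinearMap
      ((Module.finBasis ℝ F).equivFun.toLinearMap ∘ₗ L ∘ₗ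
        (Module.finBasis ℝ E).equivFun.symm.toLinearMap))
    ((Module.finBasis ℝ E).equivFun m)

variable {V W : Type*} [AddCommGroup V] [Module ℝ V] [FiniteDimensional ℝ V]
  [AddCommGroup W] [Module ℝ W] [FiniteDimensional ℝ W]

/-- The torsion condition for `Φ : M = V ⊕ A → C^{0,2}(A)`: `Φ` is differentiable, and
`∑_{cyclic} Φ_*|_{m} (A₁ + Q(A₁)) (A₂, A₃) = 0` for `m ∈ M`, `Q ∈ A⁽¹⁾` and `A₁, A₂, A₃ ∈ V`. -/
def TorsionCondition (A : Submodule ℝ (V →ₗ[ℝ] W)) (Φ : V × A → V [⋀^Fin 2]→ₗ[ℝ] W) : Prop :=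
  ∀ m : V × A, ∃ L : V × A →ₗ[ℝ] V [⋀^Fin 2]→ₗ[ℝ] W, HasDifferentialAt Φ L m ∧
    ∀ Q ∈ prolongation A, ∀ A₁ A₂ A₃ : V,
      L (A₁, Q A₁) ![A₂, A₃] + L (A₂, Q A₂) ![A₃, A₁] + L (A₃, Q A₃) ![A₁, A₂] = 0

end Torsion

end Tableau

/-! ### The tableau of a Cartan decomposition -/

namespace Cartan

variable {g : Type*} [LieRing g] [LieAlgebra ℝ g]

/-- `g = g₀ ⊕ m` is a Cartan decomposition of the real Lie algebra `g`. -/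
structure IsCartanDecomposition (g₀ m : Submodule ℝ g) : Prop where
  isCompl : IsCompl g₀ m
  lie_g₀_g₀ : ∀ x ∈ g₀, ∀ y ∈ g₀, ⁅x, y⁆ ∈ g₀
  lie_g₀_m : ∀ x ∈ g₀, ∀ y ∈ m, ⁅x, y⁆ ∈ m
  lie_m_m : ∀ x ∈ m, ∀ y ∈ m, ⁅x, y⁆ ∈ g₀
  orthogonal : ∀ x ∈ g₀, ∀ y ∈ m, killingForm ℝ g x y = 0
  neg_def : ∀ x ∈ g₀, x ≠ 0 → killingForm ℝ g x x < 0
  pos_def : ∀ x ∈ m, x ≠ 0 → 0 < killingForm ℝ g x x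

/-- `a` is a maximal abelian subspace of `m`. -/
def IsMaximalAbelian (m a : Submodule ℝ g) : Prop :=
  Maximal (fun s : Submodule ℝ g => s ≤ m ∧ ∀ x ∈ s, ∀ y ∈ s, ⁅x, y⁆ = 0) a

/-- The orthogonal complement, with respect to the Killing form, of `s` inside `t`. -/
def orthIn (t s : Submodule ℝ g) : Submodule ℝ g where
  carrier := {x | x ∈ t ∧ ∀ y ∈ s, killingForm ℝ g x y = 0}
  zero_mem' := ⟨t.zero_mem, fun y _ => by simp⟩
  add_mem' := fun {u v} hu hv => ⟨t.add_mem hu.1 hv.1, fun y hy => by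
    simp [hu.2 y hy, hv.2 y hy]⟩
  smul_mem' := fun c u hu => ⟨t.smul_mem c hu.1, fun y hy => by simp [hu.2 y hy]⟩

/-- The centralizer `g_a = {X ∈ g₀ : [X, a] = 0}` of `a` in `g₀`. -/
def centralizerIn (g₀ a : Submodule ℝ g) : Submodule ℝ g where
  carrier := {x | x ∈ g₀ ∧ ∀ y ∈ a, ⁅x, y⁆ = 0}
  zero_mem' := ⟨g₀.zero_mem, fun y _ => zero_lie y⟩
  add_mem' := fun {u v} hu hv => ⟨g₀.add_mem hu.1 hv.1, fun y hy => by
    rw [add_lie, hu.2 y hy, hv.2 y hy, add_zero]⟩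
  smul_mem' := fun c u hu => ⟨g₀.smul_mem c hu.1, fun y hy => by
    rw [smul_lie, hu.2 y hy, smul_zero]⟩

/-- `b = a^⊥`, the orthogonal complement of `a` in `m`. -/
abbrev bSpace (m a : Submodule ℝ g) : Submodule ℝ g := orthIn m a

/-- `p`, the orthogonal complement of the centralizer `g_a` in `g₀`. -/
abbrev pSpace (g₀ a : Submodule ℝ g) : Submodule ℝ g := orthIn g₀ (centralizerIn g₀ a)

variable {g₀ m a : Submodule ℝ g}

theorem killing_assoc (x y z : g) : killingForm ℝ g ⁅x, y⁆ z = killingForm ℝ g x ⁅y, z⁆ :=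
  LieModule.traceForm_apply_lie_apply ℝ g g x y z

theorem killing_symm (x y : g) : killingForm ℝ g x y = killingForm ℝ g y x :=
  LieModule.traceForm_comm ℝ g g x y

theorem lie_mem_pSpace (hD : IsCartanDecomposition g₀ m) (ha : IsMaximalAbelian m a)
    {x y : g} (hx : x ∈ bSpace m a) (hy : y ∈ a) : ⁅x, y⁆ ∈ pSpace g₀ a := by
  refine ⟨hD.lie_m_m x hx.1 y (ha.prop.1 hy), fun z hz => ?_⟩
  rw [killing_assoc, ← lie_skew, hz.2 y hy]
  simp

/-- The map `b → Hom(a, p)`, `B ↦ ad_B|_a`. -/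
def adMap (hD : IsCartanDecomposition g₀ m) (ha : IsMaximalAbelian m a) :
    bSpace m a →ₗ[ℝ] a →ₗ[ℝ] pSpace g₀ a :=
  LinearMap.mk₂ ℝ (fun x y => ⟨⁅(x : g), (y : g)⁆, lie_mem_pSpace hD ha x.2 y.2⟩)
    (fun x x' y => Subtype.ext (by simp))
    (fun c x y => Subtype.ext (by simp))
    (fun x y y' => Subtype.ext (by simp))
    (fun c x y => Subtype.ext (by simp))

theorem adMap_injective (hD : IsCartanDecomposition g₀ m) (ha : IsMaximalAbelian m a) :
    Function.Injective (adMap hD ha) := by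
  rw [injective_iff_map_eq_zero]
  intro x hx
  have hxa : ∀ y ∈ a, ⁅(x : g), y⁆ = 0 := fun y hy =>
    congrArg Subtype.val (LinearMap.congr_fun hx ⟨y, hy⟩)
  have hmem : (x : g) ∈ a := by
    have hle : a ⊔ Submodule.span ℝ {(x : g)} ≤ a := by
      refine ha.le_of_ge ⟨sup_le ha.prop.1 ?_, ?_⟩ le_sup_left
      · rw [Submodule.span_singleton_le_iff_mem]
        exact x.2.1
      · intro u hu v hv
        obtain ⟨u₁, hu₁, u₂, hu₂, rfl⟩ := Submodule.mem_sup.1 hu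
        obtain ⟨v₁, hv₁, v₂, hv₂, rfl⟩ := Submodule.mem_sup.1 hv
        obtain ⟨c, rfl⟩ := Submodule.mem_span_singleton.1 hu₂
        obtain ⟨d, rfl⟩ := Submodule.mem_span_singleton.1 hv₂
        have h1 : ⁅u₁, (x : g)⁆ = 0 := by rw [← lie_skew, hxa u₁ hu₁, neg_zero]
        simp [ha.prop.2 u₁ hu₁ v₁ hv₁, hxa v₁ hv₁, h1]
    exact hle (Submodule.mem_sup_right (Submodule.mem_span_singleton_self _))
  by_contra hne
  have hpos := hD.pos_def x x.2.1 (fun h => hne (Subtype.ext h))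
  rw [x.2.2 x hmem] at hpos
  exact lt_irrefl _ hpos

/-- The tableau `A ⊆ Hom(a, p)` that realizes `b`, i.e. `A = {ad_B|_a : B ∈ b}`. -/
def tableau (hD : IsCartanDecomposition g₀ m) (ha : IsMaximalAbelian m a) :
    Submodule ℝ (a →ₗ[ℝ] pSpace g₀ a) :=
  LinearMap.range (adMap hD ha)

/-- The identification `b ≃ A`, `B ↦ ad_B|_a`. -/
noncomputable def bEquiv (hD : IsCartanDecomposition g₀ m) (ha : IsMaximalAbelian m a) :
    bSpace m a ≃ₗ[ℝ] tableau hD ha :=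
  LinearEquiv.ofInjective (adMap hD ha) (adMap_injective hD ha)

theorem lie_lie_mem_pSpace (hD : IsCartanDecomposition g₀ m) (ha : IsMaximalAbelian m a)
    {B x y : g} (hB : B ∈ bSpace m a) (hx : x ∈ a) (hy : y ∈ a) :
    ⁅⁅x, B⁆, ⁅y, B⁆⁆ ∈ pSpace g₀ a := by
  have hxm := ha.prop.1 hx
  have hym := ha.prop.1 hy
  refine ⟨hD.lie_g₀_g₀ _ (hD.lie_m_m x hxm B hB.1) _ (hD.lie_m_m y hym B hB.1), fun z hz => ?_⟩
  have key : ∀ u ∈ a, ∀ v ∈ a, killingForm ℝ g z ⁅⁅u, B⁆, ⁅v, B⁆⁆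
      = - killingForm ℝ g ⁅z, B⁆ ⁅u, ⁅v, B⁆⁆ := by
    intro u hu v hv
    have h1 : ⁅z, ⁅u, B⁆⁆ = - ⁅⁅z, B⁆, u⁆ := by
      rw [leibniz_lie z u B, hz.2 u hu, zero_lie, zero_add, lie_skew]
    rw [← killing_assoc z, h1, map_neg, LinearMap.neg_apply, killing_assoc]
  have hsymm : ⁅x, ⁅y, B⁆⁆ = ⁅y, ⁅x, B⁆⁆ := by
    rw [leibniz_lie x y B, ha.prop.2 x hx y hy, zero_lie, zero_add]
  have h2 : killingForm ℝ g z ⁅⁅x, B⁆, ⁅y, B⁆⁆ = killingForm ℝ g z ⁅⁅y, B⁆, ⁅x, B⁆⁆ := by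
    rw [key x hx y hy, key y hy x hx, hsymm]
  have h3 : killingForm ℝ g z ⁅⁅y, B⁆, ⁅x, B⁆⁆ = - killingForm ℝ g z ⁅⁅x, B⁆, ⁅y, B⁆⁆ := by
    rw [← lie_skew ⁅y, B⁆ ⁅x, B⁆, map_neg]
  rw [killing_symm]
  linarith

/-- The quadratic term `Φ|_B ∈ p ⊗ Λ²a*`, `Φ|_B (A₁, A₂) = [[A₁, B], [A₂, B]]`, for `B ∈ b`. -/
noncomputable def quadTerm (hD : IsCartanDecomposition g₀ m) (ha : IsMaximalAbelian m a) (B : bSpace m a) :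
    a [⋀^Fin 2]→ₗ[ℝ] pSpace g₀ a :=
  Tableau.twoForm
    (LinearMap.mk₂ ℝ
      (fun x y => ⟨⁅⁅(x : g), (B : g)⁆, ⁅(y : g), (B : g)⁆⁆, lie_lie_mem_pSpace hD ha B.2 x.2 y.2⟩)
      (fun x x' y => Subtype.ext (by simp))
      (fun c x y => Subtype.ext (by simp))
      (fun x y y' => Subtype.ext (by simp))
      (fun c x y => Subtype.ext (by simp)))
    (fun x => Subtype.ext (lie_self _))

/-- The quadratic term as a map `Φ : M = a ⊕ A → C^{0,2}(A)`; it does not depend on the point of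
`a`, and an element `ad_B|_a` of `A` is identified with `B ∈ b`. -/
noncomputable def Phi (hD : IsCartanDecomposition g₀ m) (ha : IsMaximalAbelian m a) :
    a × tableau hD ha → a [⋀^Fin 2]→ₗ[ℝ] pSpace g₀ a :=
  fun q => quadTerm hD ha ((bEquiv hD ha).symm q.2)

end Cartan

/-! ### Linear algebra: kernels in a pencil `T + t • S`, flags through a vector -/

section LinearAlgebra

variable {K V : Type*} [Field K] [AddCommGroup V] [Module K V] [FiniteDimensional K V]

/-! Everything but the torsion condition and `Φ ∈ B^{0,2}` rests on a regular element `A ∈ a`: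
whatever commutes with `A` commutes with all of `a` (`exists_regular`). It is found by minimizing
`dim ker ad_A`. Definiteness of the Killing form makes `ker ad_A` and `range ad_A` disjoint, so for
`y ∈ a` some `ad_(A + ty)` has kernel inside `ker ad_A ∩ ker ad_y`, and minimality gives `ker ad_A ⊆
ker ad_y`.

For regular `A`, `ad_A` is injective `p → b` and `b → p`, hence bijective. So evaluation at `A` is
injective on the tableau, and a flag through `A` gives `s₁ = dim b` and no other characters. Given
`Q` in the prolongation, solve `[X, A] = Q(A)`; symmetry of `Q` then forces `Q(y) = [X, y]` for all
`y`. Hence `dim A⁽¹⁾ = dim p = dim b = s₁`, which is involutivity.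

The last two claims are Jacobi computations: `Φ|_B` is the coboundary of half the `b`-part of `x ↦
[[x, B], B]`, and the cyclic sum of the polarization of `Φ` cancels in pairs. -/

theorem LinearMap.exists_injective_add_smul [Infinite K] (T S : V →ₗ[K] V)
    (hT : Function.Injective T) : ∃ t : K, t ≠ 0 ∧ Function.Injective (T + t • S) := by
  let e := LinearEquiv.ofInjectiveEndo T hT
  let U : Module.End K V := e.symm.toLinearMap ∘ₗ S
  -- For `μ ≠ 0`, `T - μ⁻¹ S` has a kernel exactly when `μ` is an eigenvalue of `T⁻¹ S`, and there
  -- are finitely many of those.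
  obtain ⟨μ, hμ⟩ := (U.finite_hasEigenvalue.union (Set.finite_singleton (0 : K))).exists_notMem
  simp only [Set.mem_union, Set.mem_ofPred_eq, Set.mem_singleton_iff, not_or] at hμ
  refine ⟨-μ⁻¹, neg_ne_zero.2 (inv_ne_zero hμ.2), ?_⟩
  rw [injective_iff_map_eq_zero]
  intro x hx
  by_contra hne
  refine hμ.1 (Module.End.hasEigenvalue_of_hasEigenvector
    (Module.End.hasEigenvector_iff.2 ⟨Module.End.mem_eigenspace_iff.2 ?_, hne⟩))
  have h1 : T x = μ⁻¹ • S x := by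
    have : T x + -μ⁻¹ • S x = 0 := hx
    rwa [neg_smul, ← sub_eq_add_neg, sub_eq_zero] at this
  change e.symm (S x) = μ • x
  rw [LinearEquiv.symm_apply_eq, map_smul]
  change S x = μ • T x
  rw [h1, smul_inv_smul₀ hμ.2]

/-- If `S` commutes with `T` and `V = ker T ⊕ range T`, then some `T + t S` has the kernel
`ker T ∩ ker S`. -/
theorem LinearMap.exists_ker_add_smul_le [Infinite K] (T S : V →ₗ[K] V) (hc : Commute T S)
    (hd : Disjoint T.ker T.range) :
    ∃ t : K, t ≠ 0 ∧ (T + t • S).ker ≤ T.ker ⊓ S.ker := by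
  have hcompl : IsCompl T.ker T.range := by
    refine (Submodule.isCompl_iff_disjoint _ _ ?_).2 hd
    rw [add_comm, LinearMap.finrank_range_add_finrank_ker]
  have hTS : ∀ x, T (S x) = S (T x) := fun x => LinearMap.congr_fun hc.eq x
  have hTR : ∀ x ∈ T.range, T x ∈ T.range := fun x _ => ⟨x, rfl⟩
  have hSR : ∀ x ∈ T.range, S x ∈ T.range := by
    rintro _ ⟨y, rfl⟩
    exact ⟨S y, hTS y⟩
  obtain ⟨t, ht, hinj⟩ := LinearMap.exists_injective_add_smul (T.restrict hTR) (S.restrict hSR) (by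
    rw [injective_iff_map_eq_zero]
    intro x hx
    exact Subtype.ext (Submodule.disjoint_def.1 hd x (congrArg Subtype.val hx) x.2))
  refine ⟨t, ht, fun x hx => ?_⟩
  obtain ⟨u, hu, v, hv, rfl⟩ := Submodule.mem_sup.1
    (show x ∈ T.ker ⊔ T.range from hcompl.sup_eq_top ▸ Submodule.mem_top)
  have hTu : T u = 0 := hu
  have hsum : t • S u + (T v + t • S v) = 0 := by
    have : T (u + v) + t • S (u + v) = 0 := hx
    rw [map_add, map_add, hTu] at this
    rw [← this]
    module
  have hSu : t • S u ∈ T.ker := by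
    rw [LinearMap.mem_ker, map_smul, hTS, hTu, map_zero, smul_zero]
  have hR : T v + t • S v ∈ T.range :=
    add_mem (hTR v hv) (T.range.smul_mem t (hSR v hv))
  -- In `hsum` the first term lies in `ker T` and the second in `range T`, so each vanishes.
  have hSu0 : t • S u = 0 := by
    refine Submodule.disjoint_def.1 hd _ hSu ?_
    rw [eq_neg_of_add_eq_zero_left hsum]
    exact neg_mem hR
  have hv0 : v = 0 := by
    rw [hSu0, zero_add] at hsum
    exact congrArg Subtype.val ((injective_iff_map_eq_zero _).1 hinj ⟨v, hv⟩ (Subtype.ext hsum))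
  rw [hv0, add_zero]
  exact ⟨hTu, (smul_eq_zero.1 hSu0).resolve_left ht⟩

/-- Every vector lies in all nonzero members of some complete flag. -/
theorem Submodule.exists_flag_mem (v : V) :
    ∃ F : ℕ → Submodule K V, Monotone F ∧
      (∀ h ≤ Module.finrank K V, Module.finrank K (F h) = h) ∧
      ∀ h, 1 ≤ h → h ≤ Module.finrank K V → v ∈ F h := by
  have step : ∀ U : Submodule K V, ∃ U', U ≤ U' ∧ (Module.finrank K U < Module.finrank K V →
      Module.finrank K U' = Module.finrank K U + 1 ∧ (U = ⊥ → v ∈ U')) := by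
    intro U
    by_cases hU : Module.finrank K U < Module.finrank K V
    · obtain ⟨w, hw⟩ : ∃ w, w ∉ U := by
        by_contra! h
        rw [(Submodule.eq_top_iff'.2 h), finrank_top] at hU
        exact lt_irrefl _ hU
      -- Only the step out of `⊥` must adjoin `v`; if `v = 0`, any line will do.
      by_cases hv : U = ⊥ ∧ v ≠ 0
      · have hvU : v ∉ U := by rw [hv.1]; simpa using hv.2
        exact ⟨U ⊔ K ∙ v, le_sup_left, fun _ => ⟨Submodule.finrank_sup_span_singleton hvU,
          fun _ => Submodule.mem_sup_right (Submodule.mem_span_singleton_self v)⟩⟩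
      · refine ⟨U ⊔ K ∙ w, le_sup_left, fun _ => ⟨Submodule.finrank_sup_span_singleton hw,
          fun h => ?_⟩⟩
        rw [not_and_not_right.1 hv h]
        exact zero_mem _
    · exact ⟨U, le_rfl, fun h => absurd h hU⟩
  choose f hle hf using step
  let F : ℕ → Submodule K V := fun h => f^[h] ⊥
  have hsucc : ∀ h, F (h + 1) = f (F h) := fun h => Function.iterate_succ_apply' f h ⊥
  have hmono : Monotone F := monotone_nat_of_le_succ fun h => hsucc h ▸ hle _
  have hrank : ∀ h ≤ Module.finrank K V, Module.finrank K (F h) = h := by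
    intro h
    induction h with
    | zero => intro _; exact finrank_bot K V
    | succ h ih =>
      intro hh
      have := ih (by omega)
      rw [hsucc, (hf (F h) (by omega)).1, this]
  refine ⟨F, hmono, hrank, fun h h1 hh => hmono h1 ?_⟩
  have h0 : Module.finrank K (⊥ : Submodule K V) = 0 := finrank_bot K V
  exact (hf ⊥ (by omega)).2 rfl

end LinearAlgebra

/-! ### Tableaux with a noncharacteristic vector; differential of a quadratic map -/

namespace Tableau

section Algebra

variable {K V W : Type*} [Field K] [AddCommGroup V] [Module K V] [AddCommGroup W] [Module K W]
  {A : Submodule K (V →ₗ[K] W)}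

theorem kerOn_eq_bot {v : V} (hv : ∀ Q ∈ A, Q v = 0 → Q = 0) {U : Submodule K V} (hU : v ∈ U) :
    kerOn A U = ⊥ :=
  (Submodule.eq_bot_iff _).2 fun Q hQ => hv Q hQ.1 (hQ.2 v hU)

variable [FiniteDimensional K V]

/-- A tableau with a noncharacteristic vector has the characters `s₁ = dim A` and `sⱼ = 0` for
`j ≥ 2`. -/
theorem hasCharacters_of_injective_eval {v : V} (hv : ∀ Q ∈ A, Q v = 0 → Q = 0) :
    HasCharacters A (fun j => if j = 1 then Module.finrank K A else 0) := by
  obtain ⟨F, hmono, hrank, hmem⟩ := Submodule.exists_flag_mem (K := K) v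
  have hzero : ∀ h, 1 ≤ h → h ≤ Module.finrank K V → Module.finrank K (kerOn A (F h)) = 0 := by
    intro h h1 hh
    rw [kerOn_eq_bot hv (hmem h h1 hh), finrank_bot]
  refine ⟨⟨F, hmono, hrank, fun h h1 hh U _ => ?_⟩, fun G hG j hj hjn => ?_⟩
  · rw [hzero h h1 hh]
    exact Nat.zero_le _
  -- The flag through `v` attains kernel dimension `0`, so every generic flag does.
  · have hle := hG.generic j hj hjn (F j) (by rw [hrank j hjn, hG.finrank_eq j hjn])
    rw [hzero j hj hjn, Nat.le_zero] at hle
    rw [hle, add_zero, Finset.sum_ite_eq' (Finset.Icc 1 j) 1, if_pos (Finset.mem_Icc.2 ⟨le_rfl, hj⟩)]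

theorem isInvolutive_of_injective_eval {v : V} (hv : ∀ Q ∈ A, Q v = 0 → Q = 0)
    (hA : Module.finrank K (prolongation A) = Module.finrank K A) : IsInvolutive A := by
  refine ⟨_, hasCharacters_of_injective_eval hv, ?_⟩
  simp only [mul_ite, mul_zero, Finset.sum_ite_eq', one_mul]
  split_ifs with h
  · exact hA
  -- The index set misses `1` only when `V = 0`, and then the prolongation is zero too.
  · have h0 : Module.finrank K V = 0 := by
      by_contra hne
      exact h (Finset.mem_Icc.2 ⟨le_rfl, Nat.one_le_iff_ne_zero.2 hne⟩)
    have := Module.finrank_zero_iff.1 h0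
    exact Module.finrank_zero_of_subsingleton

end Algebra

section Torsion

variable {E F : Type*} [AddCommGroup E] [Module ℝ E] [FiniteDimensional ℝ E]
  [AddCommGroup F] [Module ℝ F] [FiniteDimensional ℝ F]

/-- The product rule, applied in the basis coordinates that define `HasDifferentialAt`. -/
theorem hasDifferentialAt_bilinear_diag (β : E →ₗ[ℝ] E →ₗ[ℝ] F) (m : E) :
    HasDifferentialAt (fun x => β x x) (β m + β.flip m) m := by
  let bE := (Module.finBasis ℝ E).equivFun
  let bF := (Module.finBasis ℝ F).equivFun
  let γ : (Fin (Module.finrank ℝ E) → ℝ) →L[ℝ] (Fin (Module.finrank ℝ E) → ℝ) →L[ℝ]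
      (Fin (Module.finrank ℝ F) → ℝ) :=
    LinearMap.toContinuousLinearMap (LinearMap.toContinuousLinearMap.toLinearMap ∘ₗ
      (β.compl₁₂ bE.symm.toLinearMap bE.symm.toLinearMap).compr₂ bF.toLinearMap)
  have hγ : ∀ x y, γ x y = bF (β (bE.symm x) (bE.symm y)) := fun x y => rfl
  have h := (γ.hasFDerivAt_of_bilinear (hasFDerivAt_id (bE m)) (hasFDerivAt_id (bE m)))
  unfold HasDifferentialAt
  convert! h using 1
  ext1 x
  have hx : LinearMap.toContinuousLinearMap (bF.toLinearMap ∘ₗ (β m + β.flip m) ∘ₗ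
      bE.symm.toLinearMap) x = bF (β m (bE.symm x) + β (bE.symm x) m) := rfl
  refine hx.trans ?_
  simp [hγ]

end Torsion

end Tableau

/-! ### Regular elements and the prolongation -/

namespace Cartan

section Decomposition

variable {g : Type*} [LieRing g] [LieAlgebra ℝ g] {g₀ m a : Submodule ℝ g}

/-- By invariance, `[A, [A, u]] = 0` makes `[A, u]` isotropic. Since `ad_A` swaps `g₀` and `m`, the
two components of `x` separate, and the form is definite on each summand. This replaces
diagonalizability of `ad_A`: its kernel and range are disjoint. -/
theorem IsCartanDecomposition.lie_eq_zero_of_lie_lie_eq_zero (hD : IsCartanDecomposition g₀ m)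
    {A x : g} (hA : A ∈ m) (hx : ⁅A, ⁅A, x⁆⁆ = 0) : ⁅A, x⁆ = 0 := by
  have hlie : ∀ u ∈ g₀, ⁅A, u⁆ ∈ m := fun u hu => by
    rw [← lie_skew]
    exact neg_mem (hD.lie_g₀_m u hu A hA)
  have hself : ∀ u, ⁅A, ⁅A, u⁆⁆ = 0 → killingForm ℝ g ⁅A, u⁆ ⁅A, u⁆ = 0 := fun u hu => by
    rw [← neg_eq_zero, ← LinearMap.neg_apply, ← map_neg, lie_skew, killing_assoc, hu,
      map_zero]
  obtain ⟨u, hu, v, hv, rfl⟩ := Submodule.mem_sup.1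
    (show x ∈ g₀ ⊔ m from hD.isCompl.sup_eq_top ▸ Submodule.mem_top)
  rw [lie_add, lie_add] at hx
  have hu0 : ⁅A, ⁅A, u⁆⁆ ∈ g₀ := hD.lie_m_m A hA _ (hlie u hu)
  have hv0 : ⁅A, ⁅A, v⁆⁆ ∈ m := hlie _ (hD.lie_m_m A hA v hv)
  have hu1 : ⁅A, ⁅A, u⁆⁆ = 0 := by
    refine Submodule.disjoint_def.1 hD.isCompl.disjoint _ hu0 ?_
    rw [eq_neg_of_add_eq_zero_left hx]
    exact neg_mem hv0
  have hv1 : ⁅A, ⁅A, v⁆⁆ = 0 := by rwa [hu1, zero_add] at hx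
  have hu2 : ⁅A, u⁆ = 0 := by
    by_contra hne
    exact (hD.pos_def _ (hlie u hu) hne).ne' (hself u hu1)
  have hv2 : ⁅A, v⁆ = 0 := by
    by_contra hne
    exact (hD.neg_def _ (hD.lie_m_m A hA v hv) hne).ne (hself v hv1)
  rw [lie_add, hu2, hv2, add_zero]

/-- A maximal abelian subspace contains a regular element. -/
theorem exists_regular [FiniteDimensional ℝ g] (hD : IsCartanDecomposition g₀ m)
    (ha : IsMaximalAbelian m a) :
    ∃ A ∈ a, ∀ x : g, ⁅A, x⁆ = 0 → ∀ y ∈ a, ⁅y, x⁆ = 0 := by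
  obtain ⟨A, hA⟩ := exists_minimalFor_of_wellFoundedLT (· ∈ a)
    (fun A => Module.finrank ℝ (LieAlgebra.ad ℝ g A).ker) ⟨0, a.zero_mem⟩
  refine ⟨A, hA.prop, fun x hx y hy => ?_⟩
  have hc : Commute (LieAlgebra.ad ℝ g A) (LieAlgebra.ad ℝ g y) := by
    refine LinearMap.ext fun z => ?_
    change ⁅A, ⁅y, z⁆⁆ = ⁅y, ⁅A, z⁆⁆
    rw [leibniz_lie A y z, ha.prop.2 A hA.prop y hy, zero_lie, zero_add]
  have hd : Disjoint (LieAlgebra.ad ℝ g A).ker (LieAlgebra.ad ℝ g A).range := by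
    rw [Submodule.disjoint_def]
    rintro _ hu ⟨u, rfl⟩
    exact hD.lie_eq_zero_of_lie_lie_eq_zero (ha.prop.1 hA.prop) hu
  obtain ⟨t, -, hle⟩ := LinearMap.exists_ker_add_smul_le _ _ hc hd
  have hmem : A + t • y ∈ a := a.add_mem hA.prop (a.smul_mem t hy)
  rw [← map_smul, ← map_add] at hle
  have hle' := hle.trans inf_le_left
  -- `A + ty` lies in `a`, so its smaller centralizer must, by minimality, be that of `A`.
  have heq := Submodule.eq_of_le_of_finrank_le hle'
    (hA.le_of_le hmem (Submodule.finrank_mono hle'))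
  have hxk : x ∈ (LieAlgebra.ad ℝ g A).ker := hx
  rw [← heq] at hxk
  exact (hle hxk).2

theorem bEquiv_apply (hD : IsCartanDecomposition g₀ m) (ha : IsMaximalAbelian m a)
    (B : bSpace m a) (y : a) :
    (((bEquiv hD ha B : a →ₗ[ℝ] pSpace g₀ a) y : pSpace g₀ a) : g) = ⁅(B : g), (y : g)⁆ := rfl

theorem coe_tableau_apply (hD : IsCartanDecomposition g₀ m) (ha : IsMaximalAbelian m a)
    (Q : tableau hD ha) (y : a) :
    (((Q : a →ₗ[ℝ] pSpace g₀ a) y : pSpace g₀ a) : g) = ⁅((bEquiv hD ha).symm Q : g), (y : g)⁆ := by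
  rw [← bEquiv_apply, LinearEquiv.apply_symm_apply]

theorem eq_zero_of_mem_bSpace (hD : IsCartanDecomposition g₀ m) (ha : IsMaximalAbelian m a)
    {B : g} (hB : B ∈ bSpace m a) (h : ∀ y ∈ a, ⁅y, B⁆ = 0) : B = 0 := by
  refine congrArg Subtype.val ((injective_iff_map_eq_zero _).1 (adMap_injective hD ha) ⟨B, hB⟩ ?_)
  ext y
  change ⁅B, (y : g)⁆ = 0
  rw [← lie_skew, h y y.2, neg_zero]

/-- Such an `X` lies in `g_a` and is orthogonal to it, so `κ(X, X) = 0` on the negative definite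
`g₀`. -/
theorem eq_zero_of_mem_pSpace (hD : IsCartanDecomposition g₀ m)
    {X : g} (hX : X ∈ pSpace g₀ a) (h : ∀ y ∈ a, ⁅y, X⁆ = 0) : X = 0 := by
  by_contra hne
  refine (hD.neg_def X hX.1 hne).ne (hX.2 X ⟨hX.1, fun y hy => ?_⟩)
  rw [← lie_skew, h y hy, neg_zero]

theorem lie_mem_bSpace (hD : IsCartanDecomposition g₀ m) (ha : IsMaximalAbelian m a)
    {X y : g} (hX : X ∈ g₀) (hy : y ∈ a) : ⁅X, y⁆ ∈ bSpace m a := by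
  refine ⟨hD.lie_g₀_m X hX y (ha.prop.1 hy), fun z hz => ?_⟩
  rw [killing_assoc, ha.prop.2 y hy z hz, map_zero]

/-- The map `p → Hom(a, b)`, `X ↦ ad_X|_a`. -/
def lieMap (hD : IsCartanDecomposition g₀ m) (ha : IsMaximalAbelian m a) :
    pSpace g₀ a →ₗ[ℝ] a →ₗ[ℝ] bSpace m a :=
  LinearMap.mk₂ ℝ (fun X y => ⟨⁅(X : g), (y : g)⁆, lie_mem_bSpace hD ha X.2.1 y.2⟩)
    (fun x x' y => Subtype.ext (by simp))
    (fun c x y => Subtype.ext (by simp))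
    (fun x y y' => Subtype.ext (by simp))
    (fun c x y => Subtype.ext (by simp))

theorem coe_lieMap (hD : IsCartanDecomposition g₀ m) (ha : IsMaximalAbelian m a)
    (X : pSpace g₀ a) (y : a) : (lieMap hD ha X y : g) = ⁅(X : g), (y : g)⁆ := rfl

/-- `ad_y` and `ad_z` commute because `a` is abelian; this is the symmetry required by the
prolongation. -/
theorem lie_lie_comm (ha : IsMaximalAbelian m a) (X : g) {y z : g} (hy : y ∈ a) (hz : z ∈ a) :
    ⁅⁅X, y⁆, z⁆ = ⁅⁅X, z⁆, y⁆ := by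
  rw [lie_lie X y z, lie_lie X z y, ha.prop.2 y hy z hz, ha.prop.2 z hz y hy, lie_zero,
    zero_sub, zero_sub, ← lie_skew y, neg_neg, ← lie_skew z, neg_neg, lie_lie X z y,
    ha.prop.2 z hz y hy, lie_zero, zero_sub, ← lie_skew z, neg_neg]

/-- The map `p → A⁽¹⁾` that sends `X` to `y ↦ ad_[X, y]|_a`. -/
noncomputable def prolongMap (hD : IsCartanDecomposition g₀ m) (ha : IsMaximalAbelian m a) :
    pSpace g₀ a →ₗ[ℝ] Tableau.prolongation (tableau hD ha) :=
  LinearMap.codRestrict _ (LinearMap.compRight ℝ (bEquiv hD ha).toLinearMap ∘ₗ lieMap hD ha)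
    fun X y z => Subtype.ext (lie_lie_comm ha X y.2 z.2)

theorem coe_prolongMap (hD : IsCartanDecomposition g₀ m) (ha : IsMaximalAbelian m a)
    (X : pSpace g₀ a) (y : a) :
    (prolongMap hD ha X : a →ₗ[ℝ] tableau hD ha) y = bEquiv hD ha (lieMap hD ha X y) := rfl

theorem prolongMap_injective (hD : IsCartanDecomposition g₀ m) (ha : IsMaximalAbelian m a) :
    Function.Injective (prolongMap hD ha) := by
  rw [injective_iff_map_eq_zero]
  intro X hX
  refine Subtype.ext (eq_zero_of_mem_pSpace hD X.2 fun y hy => ?_)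
  have h : bEquiv hD ha (lieMap hD ha X ⟨y, hy⟩) = 0 := by
    rw [← coe_prolongMap, hX]
    rfl
  have h' := congrArg Subtype.val ((LinearEquiv.map_eq_zero_iff _).1 h)
  rw [coe_lieMap] at h'
  rw [← lie_skew, h']
  exact neg_zero

/-- For `A ∈ a` regular, `ad_A` maps `p` bijectively onto `b`. -/
theorem bijective_lieMap_flip [FiniteDimensional ℝ g] (hD : IsCartanDecomposition g₀ m)
    (ha : IsMaximalAbelian m a) (A : a) (hA : ∀ x : g, ⁅(A : g), x⁆ = 0 → ∀ y ∈ a, ⁅y, x⁆ = 0) :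
    Function.Bijective ((lieMap hD ha).flip A) := by
  have h1 : Function.Injective ((lieMap hD ha).flip A) := by
    rw [injective_iff_map_eq_zero]
    intro X hX
    refine Subtype.ext (eq_zero_of_mem_pSpace hD X.2 (hA X ?_))
    have h : ⁅(X : g), (A : g)⁆ = 0 := congrArg Subtype.val hX
    rw [← lie_skew, h, neg_zero]
  have h2 : Function.Injective ((adMap hD ha).flip A) := by
    rw [injective_iff_map_eq_zero]
    intro B hB
    refine Subtype.ext (eq_zero_of_mem_bSpace hD ha B.2 (hA B ?_))
    have h : ⁅(B : g), (A : g)⁆ = 0 := congrArg Subtype.val hB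
    rw [← lie_skew, h, neg_zero]
  -- Injections in both directions give `dim p = dim b`.
  exact ⟨h1, (LinearMap.injective_iff_surjective_of_finrank_eq_finrank
    (le_antisymm (LinearMap.finrank_le_finrank_of_injective h1)
      (LinearMap.finrank_le_finrank_of_injective h2))).1 h1⟩

theorem prolongMap_surjective [FiniteDimensional ℝ g] (hD : IsCartanDecomposition g₀ m)
    (ha : IsMaximalAbelian m a) : Function.Surjective (prolongMap hD ha) := by
  obtain ⟨A, hAa, hA⟩ := exists_regular hD ha
  intro Q
  obtain ⟨X, hX⟩ := (bijective_lieMap_flip hD ha ⟨A, hAa⟩ hA).2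
    ((bEquiv hD ha).symm (Q.1 ⟨A, hAa⟩))
  refine ⟨X, Subtype.ext (LinearMap.ext fun y => ?_)⟩
  rw [coe_prolongMap, ← LinearEquiv.eq_symm_apply, ← sub_eq_zero]
  -- With `Q` read in `b`, the difference `[X, y] - Q(y)` lies in `b`, so by regularity it suffices
  -- that it commutes with `A`: `[Q(y), A] = [Q(A), y] = [[X, A], y] = [[X, y], A]`.
  refine Subtype.ext (eq_zero_of_mem_bSpace hD ha (Subtype.mem _) (hA _ ?_))
  have hX' : ⁅(X : g), A⁆ = ((bEquiv hD ha).symm (Q.1 ⟨A, hAa⟩) : g) := congrArg Subtype.val hX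
  have hQ : ⁅((bEquiv hD ha).symm (Q.1 y) : g), A⁆
      = ⁅((bEquiv hD ha).symm (Q.1 ⟨A, hAa⟩) : g), (y : g)⁆ := by
    rw [← coe_tableau_apply hD ha (Q.1 y) ⟨A, hAa⟩, ← coe_tableau_apply hD ha (Q.1 ⟨A, hAa⟩) y]
    exact congrArg Subtype.val (Q.2 y ⟨A, hAa⟩)
  rw [← lie_skew, neg_eq_zero, Submodule.coe_sub, sub_lie, coe_lieMap, hQ, ← hX',
    lie_lie_comm ha X y.2 hAa, sub_self]

/-- The isomorphism `p ≃ A⁽¹⁾`. -/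
noncomputable def prolongEquiv [FiniteDimensional ℝ g] (hD : IsCartanDecomposition g₀ m)
    (ha : IsMaximalAbelian m a) :
    pSpace g₀ a ≃ₗ[ℝ] Tableau.prolongation (tableau hD ha) :=
  LinearEquiv.ofBijective (prolongMap hD ha)
    ⟨prolongMap_injective hD ha, prolongMap_surjective hD ha⟩

end Decomposition

section Characters

variable {g : Type*} [LieRing g] [LieAlgebra ℝ g] [FiniteDimensional ℝ g] {g₀ m a : Submodule ℝ g}

theorem exists_injective_eval (hD : IsCartanDecomposition g₀ m) (ha : IsMaximalAbelian m a) :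
    ∃ A : a, ∀ Q ∈ tableau hD ha, Q A = 0 → Q = 0 := by
  obtain ⟨A, hAa, hA⟩ := exists_regular hD ha
  refine ⟨⟨A, hAa⟩, ?_⟩
  rintro _ ⟨B, rfl⟩ hB
  have h : ⁅(B : g), A⁆ = 0 := congrArg Subtype.val hB
  have hB0 : B = 0 := by
    refine Subtype.ext (eq_zero_of_mem_bSpace hD ha B.2 (hA B ?_))
    rw [← lie_skew, h, neg_zero]
  rw [hB0, map_zero]

theorem finrank_prolongation (hD : IsCartanDecomposition g₀ m) (ha : IsMaximalAbelian m a) :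
    Module.finrank ℝ (Tableau.prolongation (tableau hD ha))
      = Module.finrank ℝ (tableau hD ha) := by
  obtain ⟨A, hAa, hA⟩ := exists_regular hD ha
  rw [← (prolongEquiv hD ha).finrank_eq, ← (bEquiv hD ha).finrank_eq]
  exact (LinearEquiv.ofBijective _ (bijective_lieMap_flip hD ha ⟨A, hAa⟩ hA)).finrank_eq

end Characters

/-! ### The quadratic term: coboundary and torsion condition -/

section Torsion

variable {g : Type*} [LieRing g] [LieAlgebra ℝ g] {g₀ m a : Submodule ℝ g}

theorem coe_quadTerm (hD : IsCartanDecomposition g₀ m) (ha : IsMaximalAbelian m a)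
    (B : bSpace m a) (v : Fin 2 → a) :
    (quadTerm hD ha B v : g) = ⁅⁅(v 0 : g), (B : g)⁆, ⁅(v 1 : g), (B : g)⁆⁆ := rfl

theorem coe_spencerDelta (hD : IsCartanDecomposition g₀ m) (ha : IsMaximalAbelian m a)
    (φ : a →ₗ[ℝ] tableau hD ha) (v : Fin 2 → a) :
    (Tableau.spencerDelta _ φ v : g) = ⁅((bEquiv hD ha).symm (φ (v 1)) : g), (v 0 : g)⁆ -
      ⁅((bEquiv hD ha).symm (φ (v 0)) : g), (v 1 : g)⁆ := by
  rw [← coe_tableau_apply, ← coe_tableau_apply]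
  rfl

/-- Along `a`, every element of `m` acts as its component in `b`. -/
theorem exists_proj_bSpace [FiniteDimensional ℝ g] (hD : IsCartanDecomposition g₀ m)
    (ha : IsMaximalAbelian m a) :
    ∃ π : m →ₗ[ℝ] bSpace m a, ∀ (z : m), ∀ y ∈ a, ⁅(π z : g), y⁆ = ⁅(z : g), y⁆ := by
  have hcompl : IsCompl a ((killingForm ℝ g).orthogonal a) := by
    refine LinearMap.BilinForm.isCompl_orthogonal_of_restrict_nondegenerate
      (fun x y h => by rw [killing_symm]; exact h) ?_
    -- The form is positive definite on `a ⊆ m`, hence nondegenerate there.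
    refine ⟨fun x hx => ?_, fun x hx => ?_⟩ <;>
    · by_contra hne
      exact (hD.pos_def x (ha.prop.1 x.2) fun h => hne (Subtype.ext h)).ne' (hx x)
  let P : g →ₗ[ℝ] g := Submodule.projection _ _ hcompl.symm
  have hP : ∀ z, z - P z ∈ a := Submodule.sub_projection_mem hcompl.symm
  have hP' : ∀ z, P z ∈ (killingForm ℝ g).orthogonal a :=
    Submodule.projection_apply_mem hcompl.symm
  have hPb : ∀ z ∈ m, P z ∈ bSpace m a := fun z hz => by
    refine ⟨?_, fun y hy => ?_⟩
    · rw [← sub_sub_cancel z (P z)]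
      exact m.sub_mem hz (ha.prop.1 (hP z))
    · rw [killing_symm]
      exact hP' z y hy
  refine ⟨P.restrict hPb, fun z y hy => ?_⟩
  change ⁅P z, y⁆ = _
  have := ha.prop.2 _ (hP z) y hy
  rwa [sub_lie, sub_eq_zero, eq_comm] at this

theorem quadTerm_mem_B02 [FiniteDimensional ℝ g] (hD : IsCartanDecomposition g₀ m)
    (ha : IsMaximalAbelian m a) (B : bSpace m a) :
    quadTerm hD ha B ∈ Tableau.B02 (tableau hD ha) := by
  obtain ⟨π, hπ⟩ := exists_proj_bSpace hD ha
  have hmem : ∀ x ∈ a, ⁅⁅x, (B : g)⁆, (B : g)⁆ ∈ m := fun x hx =>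
    hD.lie_g₀_m _ (hD.lie_m_m x (ha.prop.1 hx) B B.2.1) B B.2.1
  let ψ : a →ₗ[ℝ] m :=
    { toFun x := ⟨⁅⁅(x : g), (B : g)⁆, (B : g)⁆, hmem x x.2⟩
      map_add' x y := Subtype.ext (by simp only [Submodule.coe_add, add_lie])
      map_smul' c x := Subtype.ext (by
        simp only [Submodule.coe_smul, smul_lie, RingHom.id_apply]) }
  -- `[[x, B], B]` is only known to lie in `m`; `π` moves it to `b` without changing its bracket
  -- with `a`. On antisymmetrizing `key`, the terms `[[y, [x, B]], B]` cancel by `hsymm`, and `[[v₀,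
  -- B], [v₁, B]]` appears twice, whence `2⁻¹`.
  refine ⟨(2⁻¹ : ℝ) • ((bEquiv hD ha).toLinearMap ∘ₗ π ∘ₗ ψ), ?_⟩
  rw [map_smul, inv_smul_eq_iff₀ two_ne_zero]
  ext v
  rw [coe_spencerDelta]
  have hsymm : ⁅(v 0 : g), ⁅(v 1 : g), (B : g)⁆⁆ = ⁅(v 1 : g), ⁅(v 0 : g), (B : g)⁆⁆ := by
    rw [leibniz_lie (v 0 : g), ha.prop.2 _ (v 0).2 _ (v 1).2, zero_lie, zero_add]
  have key : ∀ x y : a, ⁅((bEquiv hD ha).symm (((bEquiv hD ha).toLinearMap ∘ₗ π ∘ₗ ψ) x) : g),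
      (y : g)⁆ = ⁅⁅(y : g), (B : g)⁆, ⁅(x : g), (B : g)⁆⁆ -
        ⁅⁅(y : g), ⁅(x : g), (B : g)⁆⁆, (B : g)⁆ := by
    intro x y
    have h : (bEquiv hD ha).symm (((bEquiv hD ha).toLinearMap ∘ₗ π ∘ₗ ψ) x) = π (ψ x) :=
      (bEquiv hD ha).symm_apply_apply _
    rw [h, hπ _ y y.2]
    change ⁅⁅⁅(x : g), (B : g)⁆, (B : g)⁆, (y : g)⁆ = _
    rw [← lie_skew, leibniz_lie (y : g) ⁅(x : g), (B : g)⁆, ← lie_skew ⁅(x : g), (B : g)⁆]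
    abel
  rw [key, key, ← hsymm, AlternatingMap.smul_apply, Submodule.coe_smul, coe_quadTerm,
    ← lie_skew ⁅(v 1 : g), (B : g)⁆, two_smul]
  abel

/-- Polarize `lie_lie_mem_pSpace` through `B + C`, `B` and `C`; it says nothing about a single
summand. -/
theorem polar_mem_pSpace (hD : IsCartanDecomposition g₀ m) (ha : IsMaximalAbelian m a)
    {B C x y : g} (hB : B ∈ bSpace m a) (hC : C ∈ bSpace m a) (hx : x ∈ a) (hy : y ∈ a) :
    ⁅⁅x, B⁆, ⁅y, C⁆⁆ + ⁅⁅x, C⁆, ⁅y, B⁆⁆ ∈ pSpace g₀ a := by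
  have h := sub_mem (sub_mem (lie_lie_mem_pSpace hD ha (add_mem hB hC) hx hy)
    (lie_lie_mem_pSpace hD ha hB hx hy)) (lie_lie_mem_pSpace hD ha hC hx hy)
  convert! h using 1
  simp only [lie_add, add_lie]
  abel

/-- The polarization of the quadratic term. -/
noncomputable def polarTerm (hD : IsCartanDecomposition g₀ m) (ha : IsMaximalAbelian m a)
    (B C : bSpace m a) : a [⋀^Fin 2]→ₗ[ℝ] pSpace g₀ a :=
  Tableau.twoForm
    (LinearMap.mk₂ ℝ
      (fun x y => ⟨⁅⁅(x : g), (B : g)⁆, ⁅(y : g), (C : g)⁆⁆ +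
        ⁅⁅(x : g), (C : g)⁆, ⁅(y : g), (B : g)⁆⁆, polar_mem_pSpace hD ha B.2 C.2 x.2 y.2⟩)
      (fun x x' y => Subtype.ext (by simp; abel))
      (fun c x y => Subtype.ext (by simp))
      (fun x y y' => Subtype.ext (by simp; abel))
      (fun c x y => Subtype.ext (by simp)))
    (fun x => Subtype.ext (by
      change ⁅⁅(x : g), (B : g)⁆, ⁅(x : g), (C : g)⁆⁆ + ⁅⁅(x : g), (C : g)⁆, ⁅(x : g), (B : g)⁆⁆ = 0
      rw [← lie_skew, neg_add_cancel]))

theorem coe_polarTerm (hD : IsCartanDecomposition g₀ m) (ha : IsMaximalAbelian m a)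
    (B C : bSpace m a) (v : Fin 2 → a) :
    (polarTerm hD ha B C v : g) = ⁅⁅(v 0 : g), (B : g)⁆, ⁅(v 1 : g), (C : g)⁆⁆ +
      ⁅⁅(v 0 : g), (C : g)⁆, ⁅(v 1 : g), (B : g)⁆⁆ := rfl

/-- The polarization of the quadratic term as a bilinear map. -/
noncomputable def polarBilin (hD : IsCartanDecomposition g₀ m) (ha : IsMaximalAbelian m a) :
    bSpace m a →ₗ[ℝ] bSpace m a →ₗ[ℝ] a [⋀^Fin 2]→ₗ[ℝ] pSpace g₀ a :=
  LinearMap.mk₂ ℝ (polarTerm hD ha)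
    (fun B B' C => by ext v; simp [coe_polarTerm]; abel)
    (fun c B C => by ext v; simp [coe_polarTerm])
    (fun B C C' => by ext v; simp [coe_polarTerm]; abel)
    (fun c B C => by ext v; simp [coe_polarTerm])

theorem polarTerm_comm (hD : IsCartanDecomposition g₀ m) (ha : IsMaximalAbelian m a)
    (B C : bSpace m a) : polarTerm hD ha B C = polarTerm hD ha C B := by
  ext v
  rw [coe_polarTerm, coe_polarTerm, add_comm]

theorem hasDifferentialAt_Phi [FiniteDimensional ℝ g] (hD : IsCartanDecomposition g₀ m)
    (ha : IsMaximalAbelian m a) (q : a × tableau hD ha) :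
    Tableau.HasDifferentialAt (Phi hD ha)
      (polarBilin hD ha ((bEquiv hD ha).symm q.2) ∘ₗ (bEquiv hD ha).symm.toLinearMap ∘ₗ
        LinearMap.snd ℝ a (tableau hD ha)) q := by
  let p : a × tableau hD ha →ₗ[ℝ] bSpace m a :=
    (bEquiv hD ha).symm.toLinearMap ∘ₗ LinearMap.snd ℝ a (tableau hD ha)
  -- The polarization at `(B, B)` is `2 Φ|_B`, so half of it has `Φ` as its diagonal.
  have h := Tableau.hasDifferentialAt_bilinear_diag
    ((2⁻¹ : ℝ) • (polarBilin hD ha).compl₁₂ p p) q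
  convert! h using 1
  · funext x
    change quadTerm hD ha (p x) = (2⁻¹ : ℝ) • polarTerm hD ha (p x) (p x)
    rw [eq_inv_smul_iff₀ two_ne_zero, two_smul]
    ext v
    rfl
  · refine LinearMap.ext fun x => ?_
    change polarTerm hD ha (p q) (p x) = (2⁻¹ : ℝ) • polarTerm hD ha (p q) (p x) +
      (2⁻¹ : ℝ) • polarTerm hD ha (p x) (p q)
    rw [polarTerm_comm hD ha (p x), ← add_smul]
    norm_num

/-- Write `Q(y) = ad_(C y)`; membership in the prolongation reads `[x, C y] = [y, C x]`. After this
exchange the six brackets cancel in antisymmetric pairs, such as `[[A₂, B], [A₁, C A₃]]` with `[[A₁,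
C A₃], [A₂, B]]`. -/
theorem torsionCondition_Phi [FiniteDimensional ℝ g] (hD : IsCartanDecomposition g₀ m)
    (ha : IsMaximalAbelian m a) : Tableau.TorsionCondition (tableau hD ha) (Phi hD ha) := by
  refine fun q => ⟨_, hasDifferentialAt_Phi hD ha q, fun Q hQ A₁ A₂ A₃ => Subtype.ext ?_⟩
  set B := (bEquiv hD ha).symm q.2
  let C : a → g := fun A => ((bEquiv hD ha).symm (Q A) : g)
  have hC : ∀ x y : a, ⁅(x : g), C y⁆ = ⁅(y : g), C x⁆ := fun x y => by
    rw [← lie_skew, ← lie_skew (y : g), ← coe_tableau_apply, ← coe_tableau_apply, hQ]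
  have hL : ∀ A x y : a, (polarTerm hD ha B ((bEquiv hD ha).symm (Q A)) ![x, y] : g)
      = ⁅⁅(x : g), (B : g)⁆, ⁅(y : g), C A⁆⁆ + ⁅⁅(x : g), C A⁆, ⁅(y : g), (B : g)⁆⁆ :=
    fun A x y => rfl
  change (polarTerm hD ha B ((bEquiv hD ha).symm (Q A₁)) ![A₂, A₃] : g) +
    polarTerm hD ha B ((bEquiv hD ha).symm (Q A₂)) ![A₃, A₁] +
    polarTerm hD ha B ((bEquiv hD ha).symm (Q A₃)) ![A₁, A₂] = 0
  rw [hL, hL, hL, hC A₃ A₁, hC A₂ A₁, hC A₃ A₂,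
    ← lie_skew ⁅(A₁ : g), C A₃⁆, ← lie_skew ⁅(A₁ : g), C A₂⁆, ← lie_skew ⁅(A₂ : g), C A₃⁆]
  abel

end Torsion

end Cartan

theorem mainTheorem3 {g : Type*} [LieRing g] [LieAlgebra ℝ g] [FiniteDimensional ℝ g]
    [LieAlgebra.IsSemisimple ℝ g] {g₀ m a : Submodule ℝ g}
    (hD : Cartan.IsCartanDecomposition g₀ m) (ha : Cartan.IsMaximalAbelian m a) :
    Tableau.IsInvolutive (Cartan.tableau hD ha) ∧
    Tableau.HasCharacters (Cartan.tableau hD ha)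
      (fun j => if j = 1 then Module.finrank ℝ (Cartan.bSpace m a) else 0) ∧
    (∃ e : Cartan.pSpace g₀ a ≃ₗ[ℝ] Tableau.prolongation (Cartan.tableau hD ha),
      ∀ (X : Cartan.pSpace g₀ a) (A₁ A₂ : a),
        ((((e X : a →ₗ[ℝ] Cartan.tableau hD ha) A₁ : a →ₗ[ℝ] Cartan.pSpace g₀ a) A₂ :
            Cartan.pSpace g₀ a) : g) = ⁅⁅(X : g), (A₁ : g)⁆, (A₂ : g)⁆) ∧
    (∀ q : a × Cartan.tableau hD ha, Cartan.Phi hD ha q ∈ Tableau.B02 (Cartan.tableau hD ha)) ∧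
    Tableau.TorsionCondition (Cartan.tableau hD ha) (Cartan.Phi hD ha) := by
  obtain ⟨A, hA⟩ := Cartan.exists_injective_eval hD ha
  refine ⟨Tableau.isInvolutive_of_injective_eval hA (Cartan.finrank_prolongation hD ha), ?_,
    ⟨Cartan.prolongEquiv hD ha, fun X A₁ A₂ => rfl⟩,
    fun q => Cartan.quadTerm_mem_B02 hD ha _, Cartan.torsionCondition_Phi hD ha⟩
  rw [(Cartan.bEquiv hD ha).finrank_eq]
  exact Tableau.hasCharacters_of_injective_eval hA
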